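/- A numerical semigroup is a set \(S\subseteq\mathbb{Z}_{\ge 0}\) that contains \(0\), is closed under addition, and has finite complement in \(\mathbb{Z}_{\ge 0}\). Its embedding dimension is the cardinality of its unique minimal generating set, and its numerical semigroup polynomial is \(P_S(x)=(1-x)\sum_{s\in S}x^s\). The semigroup \(S\) is called symmetric if \(P_S(x)=x^kP_S(x^{-1})\) for some integer \(k\ge 0\), and cyclotomic if every complex root of \(P_S\) lies on the unit circle. For integers \(t\ge 0\) and \(n\ge 6t+2\), let \(S_{n,t}\) be the set of all finite sums (including the empty sum \(0\)) of elements of the following list: - \(n-2t+4i\) and \(n-2t+4i+1\) for \(0\le i\le t-1\); - the integers \(n+2t,\,n+2t+1,\,\ldots,\,2n-4t-2\); - \(2n-4t+4j-1\) for \(0\le j\le t-1\). **Theorem 1.** Let \(t\ge 0\) be an integer and let \(n\ge\max\bigl(8(t+1)^3,\,40(t+2)\bigr)\) be an integer. Then \(S_{n,t}\) is a numerical semigroup of embedding dimension \(n-3t-1\); it is symmetric but not cyclotomic, and in particular \(P_{S_{n,t}}\) is not a product of cyclotomic polynomials. -/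

import Mathlib

open scoped Polynomial PowerSeries LaurentPolynomial

/-- A numerical semigroup: a set of nonnegative integers that contains zero, is closed under
addition, and contains all but finitely many nonnegative integers. -/
structure NumericalSemigroup extends AddSubmonoid ℕ where
  finite_compl' : {m : ℕ | m ∉ carrier}.Finite

/-- The generators of `S_{n,t}`: the `t` pairs `n - 2t + 4i, n - 2t + 4i + 1` (`0 ≤ i ≤ t - 1`),
the integers `n + 2t, …, 2n - 4t - 2`, and the `t` integers `2n - 4t + 4j - 1` (`0 ≤ j ≤ t - 1`).
They are used only for `n ≥ 6t + 2`, where no subtraction below is truncated. -/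
def generatorsS (n t : ℕ) : Set ℕ :=
  {m | ∃ i < t, m = n - 2 * t + 4 * i ∨ m = n - 2 * t + 4 * i + 1} ∪
  Set.Icc (n + 2 * t) (2 * n - 4 * t - 2) ∪
  {m | ∃ j < t, m = 2 * n - 4 * t + 4 * j - 1}

namespace NumericalSemigroup

/-- The minimal generators of `S`: the nonzero elements that are not a sum of two nonzero
elements of `S`. By `isLeast_minimalGenerators` this is the unique minimal generating set. -/
def minimalGenerators (S : NumericalSemigroup) : Set ℕ :=
  {a | a ∈ S.toAddSubmonoid ∧ a ≠ 0 ∧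
    ∀ b ∈ S.toAddSubmonoid, ∀ c ∈ S.toAddSubmonoid, b ≠ 0 → c ≠ 0 → a ≠ b + c}

/-- `minimalGenerators S` generates `S` and is contained in every generating set of `S`. -/
theorem isLeast_minimalGenerators (S : NumericalSemigroup) :
    IsLeast {A : Set ℕ | AddSubmonoid.closure A = S.toAddSubmonoid} S.minimalGenerators := by
  constructor
  · refine le_antisymm ((AddSubmonoid.closure_le).2 fun a ha => ha.1) ?_
    intro m
    induction m using Nat.strong_induction_on with
    | _ m ih =>
      intro hm
      by_cases h0 : m = 0
      · subst h0; exact zero_mem _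
      by_cases hmin : m ∈ S.minimalGenerators
      · exact AddSubmonoid.subset_closure hmin
      · simp only [minimalGenerators, Set.mem_ofPred_eq, not_and, not_forall, not_not] at hmin
        obtain ⟨b, hb, c, hc, hb0, hc0, rfl⟩ := hmin hm h0
        exact add_mem (ih b (by omega) hb) (ih c (by omega) hc)
  · intro A hA a ha
    obtain ⟨haS, ha0, hirr⟩ := ha
    have hA' : AddSubmonoid.closure A = S.toAddSubmonoid := hA
    have key : ∀ x ∈ AddSubmonoid.closure A, x = a → a ∈ A := by
      intro x hx
      induction hx using AddSubmonoid.closure_induction with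
      | mem x hx => rintro rfl; exact hx
      | zero => intro h; exact absurd h.symm ha0
      | add x y hx hy ihx ihy =>
        intro h
        by_cases hx0 : x = 0
        · exact ihy (by omega)
        by_cases hy0 : y = 0
        · exact ihx (by omega)
        exact absurd h.symm (hirr x (hA' ▸ hx) y (hA' ▸ hy) hx0 hy0)
    exact key a (hA' ▸ haS) rfl

/-- The embedding dimension of `S`: the number of its minimal generators. -/
noncomputable def embeddingDimension (S : NumericalSemigroup) : ℕ :=
  S.minimalGenerators.ncard

open Classical in
/-- The Hilbert series `H_S(x) = ∑_{s ∈ S} x^s`, a formal power series. -/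
noncomputable def hilbertSeries (S : NumericalSemigroup) : ℤ⟦X⟧ :=
  PowerSeries.mk fun m => if m ∈ S.toAddSubmonoid then 1 else 0

/-- `(1 - x) H_S(x)` is a polynomial. -/
theorem exists_polynomial (S : NumericalSemigroup) :
    ∃ P : ℤ[X], (P : ℤ⟦X⟧) = (1 - PowerSeries.X) * S.hilbertSeries := by
  classical
  have hfin : {m : ℕ | m ∉ S.toAddSubmonoid}.Finite := S.finite_compl'
  set G : ℤ[X] := ∑ g ∈ hfin.toFinset, Polynomial.X ^ g with hG
  have hsum : S.hilbertSeries + (G : ℤ⟦X⟧) = PowerSeries.mk 1 := by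
    ext m
    by_cases hm : m ∈ S.toAddSubmonoid <;>
      simp [hilbertSeries, hG, Polynomial.coeff_X_pow, hm]
  have h1 := PowerSeries.mk_one_mul_one_sub_eq_one ℤ
  refine ⟨1 - (1 - Polynomial.X) * G, ?_⟩
  push_cast
  rw [← hsum] at h1
  linear_combination -h1

/-- The numerical semigroup polynomial `P_S(x) = (1 - x) H_S(x)`. -/
noncomputable def polynomial (S : NumericalSemigroup) : ℤ[X] :=
  S.exists_polynomial.choose

theorem coe_polynomial (S : NumericalSemigroup) :
    (S.polynomial : ℤ⟦X⟧) = (1 - PowerSeries.X) * S.hilbertSeries :=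
  S.exists_polynomial.choose_spec

/-- `S` is symmetric: `P_S(x) = x^k P_S(x⁻¹)` for some nonnegative integer `k`, as an identity of
Laurent polynomials. -/
def IsSymmetric (S : NumericalSemigroup) : Prop :=
  ∃ k : ℕ, Polynomial.toLaurent S.polynomial =
    LaurentPolynomial.T (k : ℤ) * LaurentPolynomial.invert (Polynomial.toLaurent S.polynomial)

/-- `S` is cyclotomic: every complex root of `P_S` lies on the unit circle. -/
def IsCyclotomic (S : NumericalSemigroup) : Prop :=
  ∀ z : ℂ, Polynomial.aeval z S.polynomial = 0 → ‖z‖ = 1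

end NumericalSemigroup

/-!
Write `P` for the polynomial of `S_{n,t}`, whose Frobenius number is `2n - 1`. As `S_{n,t}` contains
`n + 2t, …, 2n - 2`, the top coefficients of `P` are `1, -1, 0, …, 0`, and Newton's identities give
power sums `1` in degrees `1, …, n - 2t - 1` for its roots. If all roots lie on the unit circle,
this forces one of them close to `1`: put `φ = π / (n - 2t)` and sum the trigonometric polynomial
`|∑ sin ((k + 1) φ) z ^ k|² (z + z⁻¹ - 2 cos φ)`, whose constant term vanishes and whose other
coefficients have positive sum, over the roots; the result is positive, so some root has
`re z > cos φ`, hence `|1 - z| < φ`. On the other hand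
`(1 + x²) P = (1 + x²) (1 - x) (1 - x ^ (2n - 1)) + x ^ (n - 2t) (1 + x ^ (4t + 2))`,
where for `|x| = 1` near `1` the first summand is small and the second has modulus close to `2`;
so every root on the unit circle satisfies `|1 - z| ≥ 1 / (2t + 3)`.
-/

section PowerSums

theorem aeval_psum_eq_aeval_esymm_one_pow {σ R A : Type*} [Fintype σ] [CommRing R] [CommRing A]
    [Algebra R A] (z : σ → A) {m : ℕ}
    (h0 : ∀ k, 2 ≤ k → k ≤ m → MvPolynomial.aeval z (MvPolynomial.esymm σ R k) = 0)
    {k : ℕ} (hk : 1 ≤ k) (hkm : k ≤ m) :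
    MvPolynomial.aeval z (MvPolynomial.psum σ R k) =
      MvPolynomial.aeval z (MvPolynomial.esymm σ R 1) ^ k := by
  classical
  induction k, hk using Nat.le_induction with
  | base => rw [pow_one, MvPolynomial.psum_one, MvPolynomial.esymm_one]
  | succ k hk ih =>
    -- Newton's identity in degree `k + 1`, where only the term `e₁ p_k` survives.
    rw [MvPolynomial.psum_eq_mul_esymm_sub_sum σ R (k + 1) k.succ_pos, map_sub, map_sum, map_mul,
      h0 (k + 1) (by omega) hkm, mul_zero, zero_sub, Finset.sum_eq_single (1, k)]
    · rw [map_mul, map_mul, ih (by omega), pow_succ' _ k]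
      simp only [map_neg, map_one, pow_one, neg_mul, one_mul, neg_neg]
    · rintro ⟨a, b⟩ hab hne
      simp only [Finset.mem_filter, Finset.HasAntidiagonal.mem_antidiagonal, Set.mem_Ioo] at hab
      have ha : a ≠ 1 := fun ha => hne (Prod.ext ha (by simp only; omega))
      rw [map_mul, map_mul, h0 a (by omega) (by omega), mul_zero, zero_mul]
    · intro hnot
      refine absurd ?_ hnot
      simp only [Finset.mem_filter, Finset.HasAntidiagonal.mem_antidiagonal, Set.mem_Ioo]
      omega

theorem sum_roots_pow_eq_neg_nextCoeff_pow {K : Type*} [Field K] {P : K[X]}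
    (hP : P.Monic) (hsplit : P.Splits) {m : ℕ}
    (h0 : ∀ i, i + 2 ≤ P.natDegree → P.natDegree ≤ i + m → P.coeff i = 0)
    {k : ℕ} (hk : 1 ≤ k) (hkm : k ≤ m) :
    (P.roots.map (· ^ k)).sum = (-P.nextCoeff) ^ k := by
  classical
  let z : P.roots → K := fun x => x
  have hesymm (l : ℕ) :
      MvPolynomial.aeval z (MvPolynomial.esymm P.roots K l) = P.roots.esymm l := by
    rw [MvPolynomial.aeval_esymm_eq_multiset_esymm, Multiset.map_univ_coe]
  have hcard : P.roots.card = P.natDegree := Polynomial.splits_iff_card_roots.1 hsplit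
  have hesymm_zero (l : ℕ) (hl : 2 ≤ l) (hlm : l ≤ m) : P.roots.esymm l = 0 := by
    rcases le_or_gt l P.natDegree with hd | hd
    · have := Polynomial.coeff_eq_esymm_roots_of_splits hsplit (P.natDegree.sub_le l)
      rw [h0 _ (by omega) (by omega), hP.leadingCoeff, one_mul, Nat.sub_sub_self hd] at this
      exact (mul_eq_zero.1 this.symm).resolve_left (pow_ne_zero _ (neg_ne_zero.2 one_ne_zero))
    · rw [Multiset.esymm, Multiset.powersetCard_eq_empty _ (hcard ▸ hd), Multiset.map_zero,
        Multiset.sum_zero]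
  have hpsum := aeval_psum_eq_aeval_esymm_one_pow (R := K) z
    (fun l hl hlm => (hesymm l).trans (hesymm_zero l hl hlm)) hk hkm
  have hsum (f : K → K) : ∑ x, f (z x) = (P.roots.map f).sum := by
    rw [← Multiset.map_univ]
    rfl
  rw [MvPolynomial.esymm_one, MvPolynomial.psum, map_sum, map_sum] at hpsum
  simp only [map_pow, MvPolynomial.aeval_X] at hpsum
  rw [hsplit.nextCoeff_eq_neg_sum_roots_of_monic hP, neg_neg, ← hsum, hpsum]
  congr 1
  simpa using hsum id

end PowerSums

section UnitCircle

open Real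

theorem sum_zpow_eq_one {σ : Type*} [Fintype σ] {z : σ → ℂ} (hz : ∀ j, ‖z j‖ = 1) {N : ℕ}
    (hp : ∀ k, 1 ≤ k → k ≤ N → ∑ j, z j ^ k = 1) {m : ℤ} (hm0 : m ≠ 0) (hm : |m| ≤ N) :
    ∑ j, z j ^ m = 1 := by
  obtain ⟨k, rfl | rfl⟩ := m.eq_nat_or_neg
  · simpa using hp k (by omega) (by simpa using hm)
  · have hconj := congrArg (starRingEnd ℂ) (hp k (by omega) (by simpa using hm))
    rw [map_sum, map_one] at hconj
    rw [← hconj]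
    exact Finset.sum_congr rfl fun j _ => by
      rw [zpow_neg, zpow_natCast, ← inv_pow, Complex.inv_eq_conj (hz j), map_pow]

theorem quadratic_mul_sum_sin_mul_pow (φ : ℝ) (z : ℂ) (n : ℕ) :
    (z ^ 2 - 2 * cos φ * z + 1) *
        ∑ k ∈ Finset.range n, (sin ((k + 1) * φ) : ℂ) * z ^ k =
      sin φ - sin ((n + 1) * φ) * z ^ n + sin (n * φ) * z ^ (n + 1) := by
  induction n with
  | zero => simp
  | succ n ih =>
    have hsin : sin (n * φ) + sin ((n + 1 + 1) * φ) =
        2 * cos φ * sin ((n + 1) * φ) := by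
      rw [show (n : ℝ) * φ = (n + 1) * φ - φ by ring,
        show ((n : ℝ) + 1 + 1) * φ = (n + 1) * φ + φ by ring, sin_sub, sin_add]
      ring
    have hsin_cast := congrArg Complex.ofReal hsin
    rw [Finset.sum_range_succ, mul_add, ih]
    push_cast at hsin_cast ⊢
    linear_combination z ^ (n + 1) * hsin_cast

/-- The polynomial `∑ k < N, sin ((k + 1) φ) z ^ k` with `φ = π / (N + 1)`, where `sin` is positive
on all coefficients. On the unit circle, `|sineSum N z|² (z + z⁻¹ - 2 cos φ)` is the trigonometric
polynomial that detects points `z` with `cos φ < re z`. -/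
noncomputable def sineSum (N : ℕ) (z : ℂ) : ℂ :=
  ∑ k ∈ Finset.range N, (sin ((k + 1) * (π / (N + 1))) : ℂ) * z ^ k

theorem quadratic_mul_sineSum (N : ℕ) (z : ℂ) :
    (z ^ 2 - 2 * cos (π / (N + 1)) * z + 1) * sineSum N z =
      sin (π / (N + 1)) * (1 + z ^ (N + 1)) := by
  have hN : (N : ℝ) + 1 ≠ 0 := by positivity
  have hsin : sin (N * (π / (N + 1))) = sin (π / (N + 1)) := by
    rw [← sin_pi_sub]
    congr 1
    field_simp
    ring
  rw [sineSum, quadratic_mul_sum_sin_mul_pow, mul_div_cancel₀ _ hN, sin_pi, hsin]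
  push_cast
  ring

-- No constant term remains on the right, so power sums `1` determine the sum over a family of `z`.
theorem normSq_sineSum_mul {z : ℂ} (hz : ‖z‖ = 1) (N : ℕ) :
    ((Complex.normSq (sineSum N z) * (2 * z.re - 2 * cos (π / (N + 1))) : ℝ) : ℂ) =
      sin (π / (N + 1)) * ∑ k ∈ Finset.range N,
        (sin ((k + 1) * (π / (N + 1))) : ℂ) *
          (z ^ (-(k + 1) : ℤ) + z ^ (N - k : ℤ)) := by
  have hz0 : z ≠ 0 := norm_ne_zero_iff.1 (hz ▸ one_ne_zero)
  have hre : ((2 * z.re : ℝ) : ℂ) = z + z⁻¹ := by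
    rw [Complex.inv_eq_conj hz, Complex.add_conj]
  have hconj : (starRingEnd ℂ) (sineSum N z) = ∑ k ∈ Finset.range N,
      (sin ((k + 1) * (π / (N + 1))) : ℂ) * z ^ (-k : ℤ) := by
    rw [sineSum, map_sum]
    refine Finset.sum_congr rfl fun k _ => ?_
    rw [map_mul, Complex.conj_ofReal, map_pow, ← Complex.inv_eq_conj hz, zpow_neg, zpow_natCast,
      inv_pow]
  calc ((Complex.normSq (sineSum N z) * (2 * z.re - 2 * cos (π / (N + 1))) : ℝ) : ℂ)
      = z⁻¹ * ((z ^ 2 - 2 * cos (π / (N + 1)) * z + 1) * sineSum N z) *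
          (starRingEnd ℂ) (sineSum N z) := by
        rw [Complex.ofReal_mul, Complex.ofReal_sub, hre, ← Complex.mul_conj]
        push_cast
        field_simp
        ring
    _ = _ := by
        rw [quadratic_mul_sineSum, hconj, mul_left_comm, mul_assoc, Finset.mul_sum]
        congr 1
        refine Finset.sum_congr rfl fun k _ => ?_
        rw [neg_add', sub_eq_add_neg (N : ℤ), zpow_sub_one₀ hz0, zpow_add₀ hz0, zpow_natCast]
        field_simp
        ring

theorem sin_add_one_mul_pi_div_pos {N k : ℕ} (hk : k < N) :
    0 < sin ((k + 1) * (π / (N + 1))) := by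
  have hkN : (k : ℝ) + 1 < N + 1 := by exact_mod_cast Nat.succ_lt_succ hk
  refine sin_pos_of_pos_of_lt_pi (by positivity) ?_
  rw [mul_div_left_comm]
  exact mul_lt_of_lt_one_right pi_pos ((div_lt_one (by positivity)).2 hkN)

theorem sum_normSq_sineSum_mul {σ : Type*} [Fintype σ] {z : σ → ℂ} (hz : ∀ j, ‖z j‖ = 1) {N : ℕ}
    (hp : ∀ k, 1 ≤ k → k ≤ N → ∑ j, z j ^ k = 1) :
    ∑ j, Complex.normSq (sineSum N (z j)) * (2 * (z j).re - 2 * cos (π / (N + 1))) =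
      sin (π / (N + 1)) * ∑ k ∈ Finset.range N, sin ((k + 1) * (π / (N + 1))) * 2 := by
  apply Complex.ofReal_injective
  rw [Complex.ofReal_sum]
  simp only [normSq_sineSum_mul (hz _) N]
  rw [← Finset.mul_sum, Finset.sum_comm]
  push_cast
  congr 1
  refine Finset.sum_congr rfl fun k hk => ?_
  have hkN := Finset.mem_range.1 hk
  rw [← Finset.mul_sum, Finset.sum_add_distrib,
    sum_zpow_eq_one hz hp (by omega) (abs_le.2 ⟨by omega, by omega⟩),
    sum_zpow_eq_one hz hp (by omega) (abs_le.2 ⟨by omega, by omega⟩), one_add_one_eq_two]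

theorem exists_cos_lt_re {σ : Type*} [Fintype σ] {z : σ → ℂ} (hz : ∀ j, ‖z j‖ = 1) {N : ℕ}
    (hN : 0 < N) (hp : ∀ k, 1 ≤ k → k ≤ N → ∑ j, z j ^ k = 1) :
    ∃ j, cos (π / (N + 1)) < (z j).re := by
  have hpos : 0 < sin (π / (N + 1)) *
      ∑ k ∈ Finset.range N, sin ((k + 1) * (π / (N + 1))) * 2 :=
    mul_pos (by simpa using sin_add_one_mul_pi_div_pos hN) <|
      Finset.sum_pos
        (fun k hk => mul_pos (sin_add_one_mul_pi_div_pos (Finset.mem_range.1 hk)) two_pos)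
        ⟨0, Finset.mem_range.2 hN⟩
  rw [← sum_normSq_sineSum_mul hz hp] at hpos
  by_contra! hle
  refine hpos.not_ge (Finset.sum_nonpos fun j _ => ?_)
  exact mul_nonpos_of_nonneg_of_nonpos (Complex.normSq_nonneg _) (by linarith [hle j])

theorem norm_one_sub_lt_of_cos_lt_re {z : ℂ} (hz : ‖z‖ = 1) {θ : ℝ} (hθ : 0 ≤ θ)
    (hcos : cos θ < z.re) : ‖1 - z‖ < θ := by
  refine lt_of_pow_lt_pow_left₀ 2 hθ ?_
  have hsq : ‖1 - z‖ ^ 2 = 2 - 2 * z.re := by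
    rw [norm_sub_sq_real, hz, norm_one, Complex.inner, map_one, mul_one]
    ring
  linarith [one_sub_sq_div_two_le_cos (x := θ)]

theorem norm_one_sub_pow_le {R : Type*} [SeminormedRing R] [NormOneClass R] {x : R}
    (hx : ‖x‖ ≤ 1) (k : ℕ) : ‖1 - x ^ k‖ ≤ k * ‖1 - x‖ := by
  have hgeom : ‖∑ i ∈ Finset.range k, x ^ i‖ ≤ k := by
    refine (norm_sum_le_of_le _ fun i _ =>
      (norm_pow_le x i).trans (pow_le_one₀ (norm_nonneg x) hx)).trans_eq ?_
    rw [Finset.sum_const, Finset.card_range, nsmul_one]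
  rw [← geom_sum_mul_neg]
  exact (norm_mul_le _ _).trans (by gcongr)

theorem two_le_mul_norm_one_sub {z : ℂ} (hz : ‖z‖ = 1) {a b c : ℕ}
    (h : (1 + z ^ 2) * ((1 - z) * (1 - z ^ a)) + z ^ b * (1 + z ^ c) = 0) :
    2 ≤ (c + 4) * ‖1 - z‖ := by
  have hpow (k : ℕ) : ‖z ^ k‖ = 1 := by rw [norm_pow, hz, one_pow]
  have hplus : ‖1 + z ^ c‖ ≤ 4 * ‖1 - z‖ :=
    calc ‖1 + z ^ c‖ = ‖z ^ b * (1 + z ^ c)‖ := by rw [norm_mul, hpow, one_mul]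
      _ = ‖1 + z ^ 2‖ * (‖1 - z‖ * ‖1 - z ^ a‖) := by
        rw [eq_neg_of_add_eq_zero_right h, norm_neg, norm_mul, norm_mul]
      _ ≤ (1 + 1) * (‖1 - z‖ * (1 + 1)) := by
        gcongr
        · exact (norm_add_le _ _).trans_eq (by rw [norm_one, hpow])
        · exact (norm_sub_le _ _).trans_eq (by rw [norm_one, hpow])
      _ = 4 * ‖1 - z‖ := by ring
  calc (2 : ℝ) = ‖(1 + z ^ c) + (1 - z ^ c)‖ := by
        rw [add_add_sub_cancel, one_add_one_eq_two, Complex.norm_two]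
    _ ≤ ‖1 + z ^ c‖ + ‖1 - z ^ c‖ := norm_add_le _ _
    _ ≤ 4 * ‖1 - z‖ + c * ‖1 - z‖ := add_le_add hplus (norm_one_sub_pow_le hz.le c)
    _ = (c + 4) * ‖1 - z‖ := by ring

end UnitCircle

namespace NumericalSemigroup

variable (S : NumericalSemigroup)

theorem coeff_polynomial_zero : S.polynomial.coeff 0 = 1 := by
  rw [← Polynomial.coeff_coe, S.coe_polynomial, sub_mul, one_mul, map_sub,
    PowerSeries.coeff_zero_X_mul]
  simp [hilbertSeries]

open Classical in
theorem coeff_polynomial_succ (k : ℕ) :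
    S.polynomial.coeff (k + 1) =
      (if k + 1 ∈ S.toAddSubmonoid then 1 else 0) - (if k ∈ S.toAddSubmonoid then 1 else 0) := by
  rw [← Polynomial.coeff_coe, S.coe_polynomial, sub_mul, one_mul, map_sub,
    PowerSeries.coeff_succ_X_mul]
  simp [hilbertSeries]

section Frobenius

variable {S} {F : ℕ} (hF : IsGreatest {m | m ∉ S.toAddSubmonoid} F)
include hF

theorem mem_of_isGreatest_lt {m : ℕ} (hm : F < m) : m ∈ S.toAddSubmonoid :=
  not_not.1 fun h => (hF.2 h).not_gt hm

theorem coeff_polynomial_of_isGreatest : S.polynomial.coeff (F + 1) = 1 := by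
  rw [coeff_polynomial_succ, if_pos (mem_of_isGreatest_lt hF F.lt_succ_self), if_neg hF.1, sub_zero]

theorem natDegree_polynomial : S.polynomial.natDegree = F + 1 := by
  refine Polynomial.natDegree_eq_of_le_of_coeff_ne_zero
    (Polynomial.natDegree_le_iff_coeff_eq_zero.2 fun i hi => ?_)
    (by rw [coeff_polynomial_of_isGreatest hF]; exact one_ne_zero)
  obtain ⟨k, rfl⟩ := Nat.exists_eq_add_one_of_ne_zero (Nat.ne_zero_of_lt hi)
  rw [coeff_polynomial_succ, if_pos (mem_of_isGreatest_lt hF (by omega)),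
    if_pos (mem_of_isGreatest_lt hF (by omega)), sub_self]

theorem monic_polynomial : S.polynomial.Monic := by
  rw [Polynomial.Monic, Polynomial.leadingCoeff, natDegree_polynomial hF,
    coeff_polynomial_of_isGreatest hF]

theorem coeff_polynomial_eq_of_add_eq
    (hdual : ∀ a b, a + b = F → (a ∈ S.toAddSubmonoid ↔ b ∉ S.toAddSubmonoid))
    {i j : ℕ} (hij : i + j = F + 1) : S.polynomial.coeff i = S.polynomial.coeff j := by
  rcases i with _ | i <;> rcases j with _ | j
  · rfl
  · rw [show j = F by omega, coeff_polynomial_zero, coeff_polynomial_of_isGreatest hF]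
  · rw [show i = F by omega, coeff_polynomial_zero, coeff_polynomial_of_isGreatest hF]
  · have hi := hdual i (j + 1) (by omega)
    have hj := hdual (i + 1) j (by omega)
    simp only [coeff_polynomial_succ]
    split_ifs <;> first | rfl | tauto

theorem isSymmetric_of_add_eq
    (hdual : ∀ a b, a + b = F → (a ∈ S.toAddSubmonoid ↔ b ∉ S.toAddSubmonoid)) :
    S.IsSymmetric := by
  have hrev : S.polynomial.reverse = S.polynomial := by
    ext i
    rw [Polynomial.coeff_reverse, natDegree_polynomial hF]
    rcases le_or_gt i (F + 1) with hi | hi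
    · rw [Polynomial.revAt_le hi]
      exact coeff_polynomial_eq_of_add_eq hF hdual (by omega)
    · rw [Polynomial.revAt_eq_self_of_lt hi]
  refine ⟨F + 1, ?_⟩
  conv_lhs => rw [← hrev, LaurentPolynomial.toLaurent_reverse, natDegree_polynomial hF]
  exact mul_comm _ _

end Frobenius

variable {S} in
theorem isCyclotomic_of_polynomial_eq_prod_cyclotomic {M : Multiset ℕ} (hM : ∀ m ∈ M, 1 ≤ m)
    (hP : S.polynomial = (M.map fun m => Polynomial.cyclotomic m ℤ).prod) : S.IsCyclotomic := by
  intro z hz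
  rw [hP, map_multiset_prod, Multiset.prod_eq_zero_iff, Multiset.map_map, Multiset.mem_map] at hz
  obtain ⟨m, hm, hmz⟩ := hz
  have hm0 : m ≠ 0 := Nat.one_le_iff_ne_zero.1 (hM m hm)
  have : NeZero (m : ℂ) := ⟨Nat.cast_ne_zero.2 hm0⟩
  rw [Function.comp_apply, ← Polynomial.eval_map_algebraMap, Polynomial.map_cyclotomic] at hmz
  exact (Polynomial.isRoot_cyclotomic_iff.1 hmz).norm'_eq_one hm0

section RunBelowFrobenius

variable {S : NumericalSemigroup} {F M : ℕ} (hF : IsGreatest {m | m ∉ S.toAddSubmonoid} F)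
  (hMF : M < F) (hrun : ∀ m, M ≤ m → m < F → m ∈ S.toAddSubmonoid)
include hF hMF hrun

theorem nextCoeff_polynomial : S.polynomial.nextCoeff = -1 := by
  obtain ⟨k, rfl⟩ := Nat.exists_eq_add_one_of_ne_zero (Nat.ne_zero_of_lt hMF)
  rw [Polynomial.nextCoeff_of_natDegree_pos (by rw [natDegree_polynomial hF]; omega),
    natDegree_polynomial hF, Nat.add_sub_cancel, coeff_polynomial_succ, if_neg hF.1,
    if_pos (hrun k (by omega) (by omega)), zero_sub]

theorem sum_aroots_polynomial_pow {k : ℕ} (hk : 1 ≤ k) (hkM : k ≤ F - M) :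
    ((S.polynomial.aroots ℂ).map (· ^ k)).sum = 1 := by
  have hmonic := monic_polynomial hF
  have hinj : Function.Injective (algebraMap ℤ ℂ) := Int.cast_injective
  rw [Polynomial.aroots, sum_roots_pow_eq_neg_nextCoeff_pow (hmonic.map _)
    (IsAlgClosed.splits _) (m := F - M) _ hk hkM, Polynomial.nextCoeff_map hinj,
    nextCoeff_polynomial hF hMF hrun, map_neg, map_one, neg_neg, one_pow]
  intro i hi hiM
  rw [hmonic.natDegree_map, natDegree_polynomial hF] at hi hiM
  obtain ⟨i, rfl⟩ := Nat.exists_eq_add_one_of_ne_zero (show i ≠ 0 by omega)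
  rw [Polynomial.coeff_map, coeff_polynomial_succ, if_pos (hrun _ (by omega) (by omega)),
    if_pos (hrun _ (by omega) (by omega)), sub_self, map_zero]

theorem IsCyclotomic.exists_root_norm_one_sub_lt (hS : S.IsCyclotomic) :
    ∃ z : ℂ, Polynomial.aeval z S.polynomial = 0 ∧ ‖1 - z‖ < Real.pi / ((F - M : ℕ) + 1) := by
  classical
  have hroot (j : S.polynomial.aroots ℂ) : Polynomial.aeval (j : ℂ) S.polynomial = 0 :=
    (Polynomial.mem_aroots'.1 Multiset.coe_mem).2
  obtain ⟨j, hj⟩ := exists_cos_lt_re (z := fun j : S.polynomial.aroots ℂ => (j : ℂ))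
    (fun j => hS _ (hroot j)) (Nat.sub_pos_of_lt hMF) fun k hk hkM => by
      rw [← sum_aroots_polynomial_pow hF hMF hrun hk hkM, ← Multiset.map_univ]
      rfl
  exact ⟨j, hroot j, norm_one_sub_lt_of_cos_lt_re (hS _ (hroot j)) (by positivity) hj⟩

end RunBelowFrobenius

end NumericalSemigroup

/-- The numerical semigroup `S_{n,t}`, given by its elements instead of its generators: up to
`n + 2t` it consists of `0` and of pairs repeating with period `4` from `n - 2t` on, and above
`n + 2t` only `2n - 1` is missing. -/
def semigroupS {n t : ℕ} (hn : 6 * t + 3 ≤ n) : NumericalSemigroup where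
  carrier := {k | k = 0 ∨ (n - 2 * t ≤ k ∧ k < n + 2 * t ∧ (k - (n - 2 * t)) % 4 < 2) ∨
    (n + 2 * t ≤ k ∧ k ≠ 2 * n - 1)}
  zero_mem' := Or.inl rfl
  add_mem' {a b} ha hb := by
    simp only [Set.mem_ofPred_eq] at ha hb ⊢
    omega
  finite_compl' := (Set.finite_Iio (2 * n)).subset fun k hk => by
    simp only [Set.mem_ofPred_eq] at hk
    simp only [Set.mem_Iio]
    omega

theorem mem_generatorsS_iff {n t : ℕ} (hn : 6 * t + 3 ≤ n) {k : ℕ} :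
    k ∈ generatorsS n t ↔ (n - 2 * t ≤ k ∧ k < n + 2 * t ∧ (k - (n - 2 * t)) % 4 < 2) ∨
      (n + 2 * t ≤ k ∧ k + 4 * t + 2 ≤ 2 * n) ∨
      (2 * n ≤ k + 4 * t + 1 ∧ k + 1 < 2 * n ∧ (2 * n - 1 - k) % 4 = 0) := by
  constructor
  · rintro ((⟨i, hi, hk⟩ | ⟨hk, hk'⟩) | ⟨j, hj, rfl⟩) <;> omega
  · rintro (hk | hk | hk)
    · exact .inl (.inl ⟨(k - (n - 2 * t)) / 4, by omega, by omega⟩)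
    · exact .inl (.inr ⟨by omega, by omega⟩)
    · exact .inr ⟨(k + 4 * t + 1 - 2 * n) / 4, by omega, by omega⟩

theorem generatorsS_eq_coe (n t : ℕ) :
    generatorsS n t = ↑((Finset.range t).image (n - 2 * t + 4 * ·) ∪
      (Finset.range t).image (n - 2 * t + 4 * · + 1) ∪
      Finset.Icc (n + 2 * t) (2 * n - 4 * t - 2) ∪
      (Finset.range t).image (2 * n - 4 * t + 4 * · - 1)) := by
  ext k
  simp only [generatorsS, Set.mem_union, Set.mem_ofPred_eq, Set.mem_Icc, Finset.coe_union,
    Finset.coe_image, Finset.coe_range, Finset.coe_Icc, Set.mem_image, Set.mem_Iio, and_or_left,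
    exists_or, eq_comm (b := k)]

theorem ncard_generatorsS {n t : ℕ} (hn : 6 * t + 3 ≤ n) :
    (generatorsS n t).ncard = n - 3 * t - 1 := by
  rw [generatorsS_eq_coe, Set.ncard_coe_finset, Finset.card_union_of_disjoint,
    Finset.card_union_of_disjoint, Finset.card_union_of_disjoint,
    Finset.card_image_of_injective, Finset.card_image_of_injective, Finset.card_image_of_injective,
    Finset.card_range, Nat.card_Icc]
  · omega
  any_goals intro a b; simp only; omega
  all_goals
    simp only [Finset.disjoint_left, Finset.mem_union, Finset.mem_image, Finset.mem_range,
      Finset.mem_Icc]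
    grind

namespace semigroupS

variable {n t : ℕ} (hn : 6 * t + 3 ≤ n)

theorem mem_iff {k : ℕ} : k ∈ (semigroupS hn).toAddSubmonoid ↔
    k = 0 ∨ (n - 2 * t ≤ k ∧ k < n + 2 * t ∧ (k - (n - 2 * t)) % 4 < 2) ∨
      (n + 2 * t ≤ k ∧ k ≠ 2 * n - 1) :=
  Iff.rfl

theorem isGreatest_compl : IsGreatest {k | k ∉ (semigroupS hn).toAddSubmonoid} (2 * n - 1) := by
  refine ⟨?_, fun k hk => ?_⟩
  · rw [Set.mem_ofPred_eq, mem_iff]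
    omega
  · rw [Set.mem_ofPred_eq, mem_iff] at hk
    omega

theorem mem_iff_notMem {a b : ℕ} (hab : a + b = 2 * n - 1) :
    a ∈ (semigroupS hn).toAddSubmonoid ↔ b ∉ (semigroupS hn).toAddSubmonoid := by
  simp only [mem_iff]
  omega

theorem isSymmetric : (semigroupS hn).IsSymmetric :=
  NumericalSemigroup.isSymmetric_of_add_eq (isGreatest_compl hn) fun _ _ => mem_iff_notMem hn

theorem generatorsS_subset_minimalGenerators :
    generatorsS n t ⊆ (semigroupS hn).minimalGenerators := by
  intro k hk
  rw [mem_generatorsS_iff hn] at hk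
  refine ⟨?_, ?_, ?_⟩
  · rw [mem_iff]
    omega
  · omega
  · simp only [mem_iff]
    omega

theorem exists_add_eq_of_notMem_generatorsS {k : ℕ} (hk : k ∈ (semigroupS hn).toAddSubmonoid)
    (hk0 : k ≠ 0) (hkg : k ∉ generatorsS n t) :
    ∃ a ∈ (semigroupS hn).toAddSubmonoid, ∃ b ∈ (semigroupS hn).toAddSubmonoid,
      a ≠ 0 ∧ b ≠ 0 ∧ k = a + b := by
  simp only [mem_iff, mem_generatorsS_iff hn] at hk hkg ⊢
  rcases lt_or_ge k (2 * n) with hk2 | hk2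
  · -- Remainder `3` modulo `4` occurs only for generators and for the gap `2 * n - 1`.
    obtain ⟨q, r, hr, rfl⟩ : ∃ q r, r < 3 ∧ k = 2 * n - 4 * t + 4 * q + r :=
      ⟨(k + 4 * t - 2 * n) / 4, (k + 4 * t - 2 * n) % 4, by omega, by omega⟩
    exact ⟨n - 2 * t + (r + 1) / 2, by omega, n - 2 * t + 4 * q + r / 2, by omega⟩
  · -- The exceptional value is the one with `k - (n - 2 * t) = 2 * n - 1`.
    by_cases hk3 : k = 3 * n - 2 * t - 1
    · exact ⟨n - 2 * t + 1, by omega, k - (n - 2 * t + 1), by omega⟩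
    · exact ⟨n - 2 * t, by omega, k - (n - 2 * t), by omega⟩

theorem minimalGenerators_eq : (semigroupS hn).minimalGenerators = generatorsS n t := by
  refine Set.Subset.antisymm (fun k hk => ?_) (generatorsS_subset_minimalGenerators hn)
  by_contra hkg
  obtain ⟨a, ha, b, hb, ha0, hb0, hab⟩ := exists_add_eq_of_notMem_generatorsS hn hk.1 hk.2.1 hkg
  exact hk.2.2 a ha b hb ha0 hb0 hab

-- The factor `1 + X ^ 2` fills the gaps between the pairs of elements below `n + 2 * t`.
theorem one_add_X_sq_mul_hilbertSeries :
    (1 + PowerSeries.X ^ 2) * (semigroupS hn).hilbertSeries =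
      (1 + PowerSeries.X ^ 2) * (1 - PowerSeries.X ^ (2 * n - 1)) +
        (PowerSeries.X ^ (n - 2 * t) + PowerSeries.X ^ (n + 2 * t + 2)) * PowerSeries.mk 1 := by
  ext k
  simp only [add_mul, one_mul, map_add, map_sub, PowerSeries.coeff_X_pow_mul', mul_sub, mul_one,
    PowerSeries.coeff_X_pow, PowerSeries.coeff_one, NumericalSemigroup.hilbertSeries,
    PowerSeries.coeff_mk, mem_iff, Pi.one_apply]
  grind

theorem one_add_X_sq_mul_polynomial :
    (1 + Polynomial.X ^ 2) * (semigroupS hn).polynomial =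
      (1 + Polynomial.X ^ 2) * ((1 - Polynomial.X) * (1 - Polynomial.X ^ (2 * n - 1))) +
        Polynomial.X ^ (n - 2 * t) * (1 + Polynomial.X ^ (4 * t + 2)) := by
  apply Polynomial.coe_injective
  have hgeom := PowerSeries.mk_one_mul_one_sub_eq_one ℤ
  have hexp : n + 2 * t + 2 = n - 2 * t + (4 * t + 2) := by omega
  have hH := one_add_X_sq_mul_hilbertSeries hn
  rw [hexp, pow_add] at hH
  push_cast
  rw [NumericalSemigroup.coe_polynomial]
  linear_combination (1 - PowerSeries.X) * hH +
    PowerSeries.X ^ (n - 2 * t) * (1 + PowerSeries.X ^ (4 * t + 2)) * hgeom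

theorem two_le_mul_norm_one_sub_of_root {z : ℂ} (hz : ‖z‖ = 1)
    (hroot : Polynomial.aeval z (semigroupS hn).polynomial = 0) :
    2 ≤ (4 * t + 6) * ‖1 - z‖ := by
  have h := congrArg (Polynomial.aeval z) (one_add_X_sq_mul_polynomial hn)
  simp only [map_mul, map_add, map_sub, map_one, map_pow, Polynomial.aeval_X, hroot,
    mul_zero] at h
  have := two_le_mul_norm_one_sub hz h.symm
  push_cast at this
  linarith

theorem not_isCyclotomic (hn' : 9 * t + 10 ≤ n) : ¬ (semigroupS hn).IsCyclotomic := by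
  intro hS
  obtain ⟨z, hroot, hlt⟩ := hS.exists_root_norm_one_sub_lt (isGreatest_compl hn)
    (M := n + 2 * t) (by omega) fun m hm hm' => (mem_iff hn).2 (.inr (.inr ⟨hm, hm'.ne⟩))
  have hcast : ((2 * n - 1 - (n + 2 * t) : ℕ) : ℝ) + 1 = n - 2 * t := by
    rw [show 2 * n - 1 - (n + 2 * t) = n - (2 * t + 1) by omega, Nat.cast_sub (by omega)]
    push_cast
    ring
  have hlarge : (9 * t + 10 : ℝ) ≤ n := by exact_mod_cast hn'
  have ht : (0 : ℝ) ≤ t := t.cast_nonneg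
  have hpi : (2 * t + 3) * Real.pi ≤ n - 2 * t := by nlinarith [Real.pi_lt_d2]
  rw [hcast] at hlt
  refine lt_irrefl (2 : ℝ) ?_
  calc 2 ≤ (4 * t + 6) * ‖1 - z‖ := two_le_mul_norm_one_sub_of_root hn (hS z hroot) hroot
    _ < (4 * t + 6) * (Real.pi / (n - 2 * t)) := by gcongr
    _ = 2 * ((2 * t + 3) * Real.pi / (n - 2 * t)) := by ring
    _ ≤ 2 * 1 := by gcongr; exact div_le_one_of_le₀ hpi (by linarith)
    _ = 2 := mul_one 2

end semigroupS

theorem theorem1_general (t n : ℕ) (hn : 9 * t + 10 ≤ n) :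
    ∃ S : NumericalSemigroup,
      S.toAddSubmonoid = AddSubmonoid.closure (generatorsS n t) ∧
      S.embeddingDimension = n - 3 * t - 1 ∧
      S.IsSymmetric ∧
      ¬ S.IsCyclotomic ∧
      ¬ ∃ M : Multiset ℕ, (∀ m ∈ M, 1 ≤ m) ∧
        S.polynomial = (M.map fun m => Polynomial.cyclotomic m ℤ).prod := by
  have h : 6 * t + 3 ≤ n := by omega
  have hmin := semigroupS.minimalGenerators_eq h
  have hcyc := semigroupS.not_isCyclotomic h hn
  refine ⟨semigroupS h, ?_, ?_, semigroupS.isSymmetric h, hcyc, ?_⟩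
  · rw [← hmin]
    exact (semigroupS h).isLeast_minimalGenerators.1.symm
  · rw [NumericalSemigroup.embeddingDimension, hmin, ncard_generatorsS h]
  · rintro ⟨M, hM, hP⟩
    exact hcyc (NumericalSemigroup.isCyclotomic_of_polynomial_eq_prod_cyclotomic hM hP)

/-- For `n ≥ max (8(t+1)^3, 40(t+2))` the submonoid `S_{n,t}` of `ℕ` generated by `generatorsS n t`
is a numerical semigroup of embedding dimension `n - 3t - 1`; it is symmetric but not cyclotomic,
and its polynomial is not a product of cyclotomic polynomials `Φ_m`, `m ≥ 1`. -/
theorem theorem1 (t n : ℕ) (hn : max (8 * (t + 1) ^ 3) (40 * (t + 2)) ≤ n) :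
    ∃ S : NumericalSemigroup,
      S.toAddSubmonoid = AddSubmonoid.closure (generatorsS n t) ∧
      S.embeddingDimension = n - 3 * t - 1 ∧
      S.IsSymmetric ∧
      ¬ S.IsCyclotomic ∧
      ¬ ∃ M : Multiset ℕ, (∀ m ∈ M, 1 ≤ m) ∧
        S.polynomial = (M.map fun m => Polynomial.cyclotomic m ℤ).prod :=
  theorem1_general t n (by have := le_of_max_le_right hn; omega)
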